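/- For an integer $p\ge 2$ put $\nu=p/2-1$, let $\mathbb S^{p-1}$ be the Euclidean unit sphere of $\mathbb R^p$ with its surface measure, and let $$I_\nu(z)=\Big(\frac z2\Big)^{\nu}\sum_{s=0}^\infty\frac{(z/2)^{2s}}{s!\,\Gamma(\nu+s+1)}$$ be the modified Bessel function of the first kind. For $\kappa\ge 0$ let $$C_{p,\kappa}=\frac{(2\pi)^{\nu+1}I_\nu(\kappa)}{\kappa^\nu},$$ read for $\kappa=0$ as its limit $2\pi^{p/2}/\Gamma(p/2)$, the area of $\mathbb S^{p-1}$. Let $R$ be a number of blocks, with dimensions $p_i\ge 2$ and concentrations $\kappa_i\ge 0$ ($i=1,\dots,R$), and $\nu_i=p_i/2-1$. The independent multivariate von Mises--Fisher (VMF) mechanism takes an input $\underline x=(x_1,\dots,x_R)\in\prod_{i=1}^R\mathbb S^{p_i-1}$ to the random output $\underline y=(y_1,\dots,y_R)\in\prod_{i=1}^R\mathbb S^{p_i-1}$ with density $$\prod_{i=1}^R\frac1{C_{p_i,\kappa_i}}\,e^{\kappa_i x_i^Ty_i}$$ with respect to the product of the surface measures. For $\alpha\in(1,\infty)$ let $$D_\alpha(P\|Q)=\frac1{\alpha-1}\log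 \mathbb E_Q\Big[\Big(\frac{dP}{dQ}\Big)^\alpha\Big]$$ be the Rényi divergence of order $\alpha$ (equal to $+\infty$ if $P\not\ll Q$). A randomised mechanism $\mathcal M$, which assigns a probability distribution to every input, satisfies $(\alpha,\tau)$-Rényi differential privacy (RDP) with respect to an adjacency relation $\sim$ on its inputs if $D_\alpha(\mathcal M(x)\|\mathcal M(x'))\le\tau$ whenever $x\sim x'$. **Proposition.** For every $\alpha\in(1,\infty)$ the independent multivariate VMF mechanism satisfies $(\alpha,\tau_\alpha)$-RDP, where $$\tau_\alpha=\frac1{\alpha-1}\sum_{i=1}^R\left[\nu_i\log\Big(\frac1{2\alpha-1}\Big)+\log\Big(\frac{I_{\nu_i}((2\alpha-1)\kappa_i)}{I_{\nu_i}(\kappa_i)}\Big)\right],$$ with respect to every adjacency relation on $\prod_{i=1}^R\mathbb S^{p_i-1}$ (in particular when all pairs of inputs count as adjacent). For $\kappa_i=0$ the quotient of Bessel functions is read as its limit $(2\alpha-1)^{\nu_i}$ as $\kappa_i\to0^+$. -/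

import Mathlib

open MeasureTheory Filter Topology

noncomputable section

/-- The modified Bessel function of the first kind `I_ν(z)`, for real `ν ≥ 0` and `z ≥ 0`. -/
def besselI (ν z : ℝ) : ℝ :=
  (z / 2) ^ ν * ∑' s : ℕ, (z / 2) ^ (2 * s) / ((s.factorial : ℝ) * Real.Gamma (ν + s + 1))

/-- The order `ν = p / 2 - 1` attached to the dimension `p`. -/
def vmfOrder (p : ℕ) : ℝ := (p : ℝ) / 2 - 1

/-- The unit sphere of `ℝ^p` with the Euclidean norm. -/
abbrev UnitSphere (p : ℕ) : Type := Metric.sphere (0 : EuclideanSpace ℝ (Fin p)) 1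

/-- The surface measure of the unit sphere of `ℝ^p`. -/
def sphereMeasure (p : ℕ) : Measure (UnitSphere p) :=
  (volume : Measure (EuclideanSpace ℝ (Fin p))).toSphere

/-- The normalising constant `C_{p,κ} = (2π)^(ν+1) I_ν(κ) / κ^ν` for `κ > 0`. At `κ = 0`, where this
reads `0 / 0`, it is the limit `2 π^(p/2) / Γ(p/2)` (the area of the sphere); see
`tendsto_vmfNorm_zero`. -/
def vmfNorm (p : ℕ) (κ : ℝ) : ℝ :=
  if κ = 0 then 2 * Real.pi ^ ((p : ℝ) / 2) / Real.Gamma ((p : ℝ) / 2)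
  else (2 * Real.pi) ^ (vmfOrder p + 1) * besselI (vmfOrder p) κ / κ ^ vmfOrder p

/-- The quotient `I_ν(c κ) / I_ν(κ)`, continued to `κ = 0` by its limit `c ^ ν`; see
`tendsto_besselIRatio_zero`. -/
def besselIRatio (ν c κ : ℝ) : ℝ :=
  if κ = 0 then c ^ ν else besselI ν (c * κ) / besselI ν κ

/-- The density `C_{p,κ}⁻¹ exp(κ xᵀy)` of the von Mises-Fisher mechanism. -/
def vmfDensity (p : ℕ) (κ : ℝ) (x y : UnitSphere p) : ℝ :=
  1 / vmfNorm p κ *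
    Real.exp (κ * inner ℝ (x : EuclideanSpace ℝ (Fin p)) (y : EuclideanSpace ℝ (Fin p)))

/-- The independent multivariate von Mises-Fisher mechanism: on input `x = (x_1, …, x_R)` it outputs
`y = (y_1, …, y_R)` with density `∏ i, C_{p_i,κ_i}⁻¹ exp(κ_i x_iᵀy_i)` with respect to the product of
the surface measures. -/
def vmfMulti {R : ℕ} (p : Fin R → ℕ) (κ : Fin R → ℝ) (x : ∀ i, UnitSphere (p i)) :
    Measure (∀ i, UnitSphere (p i)) :=
  (Measure.pi fun i => sphereMeasure (p i)).withDensity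
    fun y => ENNReal.ofReal (∏ i, vmfDensity (p i) (κ i) (x i) (y i))

open Classical in
/-- The Rényi divergence of order `α > 1`, with values in the extended reals:
`(α - 1)⁻¹ log E_Q[(dP/dQ)^α]` if `P ≪ Q`, and `+∞` otherwise. -/
def renyiDiv {Y : Type*} [MeasurableSpace Y] (α : ℝ) (P Q : Measure Y) : EReal :=
  if P ≪ Q then ((1 / (α - 1) : ℝ) : EReal) * ENNReal.log (∫⁻ y, (P.rnDeriv Q y) ^ α ∂Q) else ⊤

/-- The randomised mechanism `M` (every `M x` is a probability distribution on the outputs) satisfies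
`(α, τ)`-Rényi differential privacy with respect to the adjacency relation `Adj` on its inputs. -/
def IsRDP {X Y : Type*} [MeasurableSpace Y] (Adj : X → X → Prop) (M : X → Measure Y) (α τ : ℝ) :
    Prop :=
  (∀ x, IsProbabilityMeasure (M x)) ∧ ∀ x x', Adj x x' → renyiDiv α (M x) (M x') ≤ (τ : EReal)

/-- As `z → 0`, the power series in `besselI ν z` tends to its constant term. -/
theorem tendsto_besselI_series_zero {ν : ℝ} (hν : 0 ≤ ν) :
    Tendsto (fun z : ℝ => ∑' s : ℕ, (z / 2) ^ (2 * s) /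
      ((s.factorial : ℝ) * Real.Gamma (ν + s + 1))) (𝓝 0) (𝓝 (1 / Real.Gamma (ν + 1))) := by
  have hG0 : 0 < Real.Gamma (ν + 1) := Real.Gamma_pos_of_pos (by linarith)
  have hG : ∀ s : ℕ, Real.Gamma (ν + 1) ≤ Real.Gamma (ν + s + 1) := by
    intro s
    induction s with
    | zero => simp
    | succ k ih =>
      have hk : (0 : ℝ) ≤ k := k.cast_nonneg
      have h : Real.Gamma (ν + (k + 1 : ℕ) + 1) = (ν + k + 1) * Real.Gamma (ν + k + 1) := by
        rw [← Real.Gamma_add_one (by linarith)]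
        push_cast
        ring_nf
      rw [h]
      nlinarith
  have hD : ∀ s : ℕ, Real.Gamma (ν + 1) ≤ (s.factorial : ℝ) * Real.Gamma (ν + s + 1) := by
    intro s
    have h1 : (1 : ℝ) ≤ s.factorial := by exact_mod_cast s.factorial_pos
    nlinarith [hG s]
  have hlim : (1 / Real.Gamma (ν + 1)) = ∑' s : ℕ, ((0 : ℝ) / 2) ^ (2 * s) /
      ((s.factorial : ℝ) * Real.Gamma (ν + s + 1)) := by
    rw [tsum_eq_single 0]
    · simp
    · intro s hs
      simp [hs]
  rw [hlim]
  refine tendsto_tsum_of_dominated_convergence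
    (bound := fun s : ℕ => (1 / 4 : ℝ) ^ s * (Real.Gamma (ν + 1))⁻¹) ?_ ?_ ?_
  · exact (summable_geometric_of_lt_one (by norm_num) (by norm_num)).mul_right _
  · intro s
    have hc : Continuous fun z : ℝ => (z / 2) ^ (2 * s) /
        ((s.factorial : ℝ) * Real.Gamma (ν + s + 1)) := by fun_prop
    exact hc.tendsto 0
  · filter_upwards [Metric.ball_mem_nhds (0 : ℝ) one_pos] with z hz s
    have hz1 : |z| < 1 := by simpa using hz
    have hz2 : (z / 2) ^ 2 ≤ 1 / 4 := by nlinarith [sq_abs z, abs_nonneg z]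
    rw [div_eq_mul_inv, pow_mul, Real.norm_of_nonneg]
    · gcongr
      exact hD s
    · have := (hG0.trans_le (hD s)).le
      positivity

/-- `vmfNorm p` is continuous from the right at `0`. -/
theorem tendsto_vmfNorm_zero {p : ℕ} (hp : 2 ≤ p) :
    Tendsto (vmfNorm p) (𝓝[>] 0) (𝓝 (vmfNorm p 0)) := by
  have hp' : (2 : ℝ) ≤ p := by exact_mod_cast hp
  have hν : 0 ≤ vmfOrder p := by unfold vmfOrder; linarith
  have h := ((tendsto_besselI_series_zero hν).mono_left
    (nhdsWithin_le_nhds (s := Set.Ioi (0 : ℝ)))).const_mul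
      ((2 * Real.pi) ^ (vmfOrder p + 1) / 2 ^ vmfOrder p)
  have h0 : vmfNorm p 0 = (2 * Real.pi) ^ (vmfOrder p + 1) / 2 ^ vmfOrder p *
      (1 / Real.Gamma (vmfOrder p + 1)) := by
    have e : vmfOrder p + 1 = (p : ℝ) / 2 := by unfold vmfOrder; ring
    have h2 : (2 : ℝ) ^ ((p : ℝ) / 2) = 2 ^ vmfOrder p * 2 := by
      rw [← e, Real.rpow_add_one two_ne_zero]
    have h3 : (0 : ℝ) < 2 ^ vmfOrder p := by positivity
    rw [vmfNorm, if_pos rfl, e, Real.mul_rpow two_pos.le Real.pi_pos.le, h2]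
    field_simp
  rw [h0]
  refine h.congr' ?_
  filter_upwards [self_mem_nhdsWithin] with κ hκ
  have hκ : 0 < κ := hκ
  have h3 : 0 < κ ^ vmfOrder p := by positivity
  rw [vmfNorm, if_neg hκ.ne', besselI, Real.div_rpow hκ.le two_pos.le]
  field_simp

/-- `besselIRatio ν c` is continuous from the right at `0`. -/
theorem tendsto_besselIRatio_zero {ν c : ℝ} (hν : 0 ≤ ν) (hc : 0 < c) :
    Tendsto (besselIRatio ν c) (𝓝[>] 0) (𝓝 (besselIRatio ν c 0)) := by
  have hG0 : 0 < Real.Gamma (ν + 1) := Real.Gamma_pos_of_pos (by linarith)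
  have hden := (tendsto_besselI_series_zero hν).mono_left
    (nhdsWithin_le_nhds (s := Set.Ioi (0 : ℝ)))
  have hmul : Tendsto (fun κ : ℝ => c * κ) (𝓝[>] 0) (𝓝 0) := by
    have : Tendsto (fun κ : ℝ => c * κ) (𝓝 0) (𝓝 (c * 0)) := (continuous_const_mul c).tendsto 0
    rw [mul_zero] at this
    exact this.mono_left nhdsWithin_le_nhds
  have h := (((tendsto_besselI_series_zero hν).comp hmul).div hden
    (one_div_pos.2 hG0).ne').const_mul (c ^ ν)
  rw [div_self (one_div_pos.2 hG0).ne', mul_one] at h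
  rw [besselIRatio, if_pos rfl]
  refine h.congr' ?_
  filter_upwards [self_mem_nhdsWithin] with κ hκ
  have hκ : 0 < κ := hκ
  have h3 : 0 < (κ / 2) ^ ν := by positivity
  have h4 : (c * κ / 2) ^ ν = c ^ ν * (κ / 2) ^ ν := by
    rw [mul_div_assoc, Real.mul_rpow hc.le (by positivity)]
  rw [besselIRatio, if_neg hκ.ne', besselI, besselI, h4]
  simp only [Function.comp_apply, Pi.div_apply]
  field_simp

end

/-!
The proof rests on the Laplace transform of the surface measure `σ` of the sphere,
`∫ exp ⟪v, y⟫ dσ(y) = vmfNorm p ‖v‖` for every vector `v` (`integral_exp_inner`). To obtain it, expand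
the exponential. The moments `∫ ⟪v, y⟫ ^ n dσ(y)` come from computing the Gaussian integral
`∫ ⟪v, x⟫ ^ n * exp (-‖x‖²)` over `ℝ^p` twice: in an orthonormal basis adapted to `v`
(`integral_inner_pow_mul_exp_neg_norm_sq`) and in polar coordinates
(`integral_inner_pow_mul_exp_polar`). The odd moments vanish, and the duplication formula for the Gamma
function identifies the even ones with the terms of the Bessel series (`integral_sphere_inner_pow`).
All terms are nonnegative, so `vmfNorm p` is monotone on `[0, ∞)` (`monotoneOn_vmfNorm`).

The product of powers `f ^ α * g ^ (1 - α)` of two von Mises-Fisher densities with directions `x` and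
`x'` is `vmfNorm p κ`⁻¹ times the exponential of `κ ⟪α x + (1 - α) x', y⟫`. Over the blocks the integral
factorises, so the Rényi divergence is `(α - 1)⁻¹` times the sum of the logarithms of
`vmfNorm p (κ ‖α x + (1 - α) x'‖) / vmfNorm p κ` (`renyiDiv_vmfMulti`). Since
`‖α x + (1 - α) x'‖ ≤ 2 α - 1` by the triangle inequality, monotonicity of `vmfNorm p` bounds every
summand by its value at `(2 α - 1) κ`, and `log_vmfNorm_mul_div` writes this as a quotient of Bessel
functions.
-/

/-! ### Gaussian integrals of monomials -/

theorem integral_pow_mul_exp_neg_sq_Ioi (n : ℕ) :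
    ∫ r in Set.Ioi (0 : ℝ), r ^ n * Real.exp (-r ^ 2) = Real.Gamma (((n : ℝ) + 1) / 2) / 2 := by
  have h := integral_rpow_mul_exp_neg_rpow (p := 2) (q := n) two_pos
    (by linarith [n.cast_nonneg (α := ℝ)])
  simp only [Real.rpow_natCast, Real.rpow_two] at h
  rw [h]
  ring

theorem integral_pow_two_mul_mul_exp_neg_sq (s : ℕ) :
    ∫ x : ℝ, x ^ (2 * s) * Real.exp (-x ^ 2) = Real.Gamma (s + 1 / 2) := by
  have h := integral_comp_abs (f := fun x : ℝ => x ^ (2 * s) * Real.exp (-x ^ 2))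
  simp only [sq_abs, pow_mul] at h
  simp only [pow_mul]
  rw [h]
  simp only [← pow_mul]
  rw [integral_pow_mul_exp_neg_sq_Ioi]
  push_cast
  rw [mul_div_cancel₀ _ two_ne_zero]
  congr 1
  ring

theorem integral_odd_pow_mul_exp_neg_sq {n : ℕ} (hn : Odd n) :
    ∫ x : ℝ, x ^ n * Real.exp (-x ^ 2) = 0 := by
  have h := integral_neg_eq_self (fun x : ℝ => x ^ n * Real.exp (-x ^ 2)) volume
  simp only [hn.neg_pow, even_two.neg_pow, neg_mul, integral_neg] at h
  linarith

/-- Every vector, zero included, is its norm times the first vector of some orthonormal basis. -/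
theorem exists_orthonormalBasis_norm_smul_eq {p : ℕ} (hp : 0 < p)
    (v : EuclideanSpace ℝ (Fin p)) :
    ∃ b : OrthonormalBasis (Fin p) ℝ (EuclideanSpace ℝ (Fin p)), v = ‖v‖ • b ⟨0, hp⟩ := by
  rcases eq_or_ne v 0 with rfl | hv
  · exact ⟨EuclideanSpace.basisFun _ _, by simp⟩
  · have ho : Orthonormal ℝ (({⟨0, hp⟩} : Set (Fin p)).domRestrict fun _ => ‖v‖⁻¹ • v) := by
      refine ⟨fun i => ?_, fun i j hij => (hij (Subsingleton.elim _ _)).elim⟩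
      simp [norm_smul, hv]
    obtain ⟨b, hb⟩ := ho.exists_orthonormalBasis_extension_of_card_eq (by simp)
    refine ⟨b, ?_⟩
    rw [hb _ rfl, smul_smul, mul_inv_cancel₀ (norm_ne_zero_iff.2 hv), one_smul]

/-- In an orthonormal basis whose first vector points along `v`, the Gaussian integral of
`⟪v, x⟫ ^ n` splits into one-dimensional integrals. -/
theorem integral_inner_pow_mul_exp_neg_norm_sq {p : ℕ} (hp : 0 < p)
    (v : EuclideanSpace ℝ (Fin p)) (n : ℕ) :
    ∫ x : EuclideanSpace ℝ (Fin p), inner ℝ v x ^ n * Real.exp (-‖x‖ ^ 2) =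
      ‖v‖ ^ n * ((∫ z : ℝ, z ^ n * Real.exp (-z ^ 2)) * √Real.pi ^ (p - 1)) := by
  obtain ⟨b, hb⟩ := exists_orthonormalBasis_norm_smul_eq hp v
  set i₀ : Fin p := ⟨0, hp⟩
  have h1 : ∀ x : EuclideanSpace ℝ (Fin p), inner ℝ v x ^ n * Real.exp (-‖x‖ ^ 2) =
      ‖v‖ ^ n * (b.repr x i₀ ^ n * Real.exp (-‖b.repr x‖ ^ 2)) := by
    intro x
    have : inner ℝ v x = ‖v‖ * b.repr x i₀ := by
      conv_lhs => rw [hb]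
      rw [real_inner_smul_left, b.repr_apply_apply]
    rw [this, mul_pow, LinearIsometryEquiv.norm_map, mul_assoc]
  simp only [h1, integral_const_mul]
  congr 1
  rw [b.measurePreserving_repr.integral_comp b.repr.toHomeomorph.measurableEmbedding
    (fun z : EuclideanSpace ℝ (Fin p) => z i₀ ^ n * Real.exp (-‖z‖ ^ 2)),
    ← (PiLp.volume_preserving_toLp (Fin p)).integral_comp
      (MeasurableEquiv.toLp 2 (Fin p → ℝ)).measurableEmbedding]
  have h2 : ∀ z : Fin p → ℝ, z i₀ ^ n *
      Real.exp (-‖(WithLp.toLp 2 z : EuclideanSpace ℝ (Fin p))‖ ^ 2) =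
      ∏ i, (if i = i₀ then z i ^ n else 1) * Real.exp (-z i ^ 2) := by
    intro z
    rw [Finset.prod_mul_distrib, ← Real.exp_sum, EuclideanSpace.norm_sq_eq]
    simp
  refine (integral_congr_ae (Eventually.of_forall h2)).trans ?_
  rw [integral_fintype_prod_volume_eq_prod
    (fun i (t : ℝ) => (if i = i₀ then t ^ n else 1) * Real.exp (-t ^ 2)),
    ← Finset.mul_prod_erase _ _ (Finset.mem_univ i₀)]
  rw [Finset.prod_congr rfl (g := fun _ => √Real.pi)]
  · simp
  · intro i hi
    simpa [Finset.ne_of_mem_erase hi] using integral_gaussian 1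

/-! ### Moments of the surface measure -/

theorem integral_volumeIoiPow (m : ℕ) (f : ℝ → ℝ) :
    ∫ r : Set.Ioi (0 : ℝ), f r ∂(Measure.volumeIoiPow m) =
      ∫ r in Set.Ioi (0 : ℝ), r ^ m * f r := by
  simp only [Measure.volumeIoiPow, ENNReal.ofReal]
  rw [integral_withDensity_eq_integral_smul,
    integral_subtype_comap measurableSet_Ioi fun a ↦ Real.toNNReal (a ^ m) • f a]
  · refine setIntegral_congr_fun measurableSet_Ioi fun x hx ↦ ?_
    simp only [NNReal.smul_def]
    rw [Real.coe_toNNReal _ (pow_nonneg hx.out.le _), smul_eq_mul]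
  · exact (measurable_subtype_coe.pow_const _).real_toNNReal

/-- The Gaussian integral of `⟪v, x⟫ ^ n` in polar coordinates: the angular part is the `n`-th moment
of the surface measure, the radial part a value of the Gamma function. -/
theorem integral_inner_pow_mul_exp_polar {p : ℕ} (hp : 0 < p)
    (v : EuclideanSpace ℝ (Fin p)) (n : ℕ) :
    ∫ x : EuclideanSpace ℝ (Fin p), inner ℝ v x ^ n * Real.exp (-‖x‖ ^ 2) =
      (∫ y : UnitSphere p, inner ℝ v (y : EuclideanSpace ℝ (Fin p)) ^ n ∂sphereMeasure p) *
        (Real.Gamma (((p : ℝ) + n) / 2) / 2) := by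
  have : Nonempty (Fin p) := ⟨⟨0, hp⟩⟩
  have h := (volume : Measure (EuclideanSpace ℝ (Fin p))).measurePreserving_homeomorphUnitSphereProd
    |>.integral_comp (Homeomorph.measurableEmbedding _)
      (fun q => inner ℝ v (q.1 : EuclideanSpace ℝ (Fin p)) ^ n *
        ((q.2 : ℝ) ^ n * Real.exp (-(q.2 : ℝ) ^ 2)))
  rw [integral_prod_mul (fun y : UnitSphere p => inner ℝ v (y : EuclideanSpace ℝ (Fin p)) ^ n)
    (fun r : Set.Ioi (0 : ℝ) => (r : ℝ) ^ n * Real.exp (-(r : ℝ) ^ 2)),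
    integral_volumeIoiPow _ fun r => r ^ n * Real.exp (-r ^ 2)] at h
  have e : ∀ r : ℝ, r ^ (Module.finrank ℝ (EuclideanSpace ℝ (Fin p)) - 1) *
      (r ^ n * Real.exp (-r ^ 2)) = r ^ (p - 1 + n) * Real.exp (-r ^ 2) := by
    intro r
    rw [finrank_euclideanSpace_fin, pow_add, mul_assoc]
  simp only [e, integral_pow_mul_exp_neg_sq_Ioi] at h
  have e2 : ((p - 1 + n : ℕ) : ℝ) + 1 = p + n := by
    have : p - 1 + n + 1 = p + n := by omega
    exact_mod_cast this
  rw [e2] at h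
  -- polar coordinates are defined off the origin, which is a null set
  rw [sphereMeasure, ← h, ← setIntegral_univ (μ := volume),
    ← Set.compl_union_self {(0 : EuclideanSpace ℝ (Fin p))},
    setIntegral_congr_set (t := {0}ᶜ) (union_ae_eq_left_of_ae_eq_empty (by simp)),
    ← integral_subtype_comap (measurableSet_singleton _).compl]
  refine integral_congr_ae (Eventually.of_forall fun x => ?_)
  have hx : ‖(x : EuclideanSpace ℝ (Fin p))‖ ≠ 0 := norm_ne_zero_iff.2 x.2
  simp only [homeomorphUnitSphereProd_apply_fst_coe, homeomorphUnitSphereProd_apply_snd_coe,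
    real_inner_smul_right, mul_pow, inv_pow]
  field_simp

/-- The even moments of the surface measure along `v`, read off from the two evaluations of
`∫ ⟪v, x⟫ ^ (2 * s) * exp (-‖x‖²)`. Legendre's duplication formula, applied to `Γ(s + 1/2)`, turns
them into the terms of the Bessel series. -/
theorem integral_sphere_inner_pow {p : ℕ} (hp : 0 < p) (v : EuclideanSpace ℝ (Fin p)) (s : ℕ) :
    (∫ y : UnitSphere p, inner ℝ v (y : EuclideanSpace ℝ (Fin p)) ^ (2 * s) ∂sphereMeasure p) /
        ((2 * s).factorial : ℝ) =
      2 * Real.pi ^ ((p : ℝ) / 2) *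
        ((‖v‖ / 2) ^ (2 * s) / ((s.factorial : ℝ) * Real.Gamma (vmfOrder p + s + 1))) := by
  have h := (integral_inner_pow_mul_exp_polar hp v (2 * s)).symm.trans
    (integral_inner_pow_mul_exp_neg_norm_sq hp v (2 * s))
  have hp' : (0 : ℝ) < p := by exact_mod_cast hp
  have e : ((p : ℝ) + (2 * s : ℕ)) / 2 = vmfOrder p + s + 1 := by
    unfold vmfOrder; push_cast; ring
  have hpi : √Real.pi * √Real.pi ^ (p - 1) = Real.pi ^ ((p : ℝ) / 2) := by
    rw [← pow_succ', Nat.sub_add_cancel hp, Real.sqrt_eq_rpow, ← Real.rpow_natCast,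
      ← Real.rpow_mul Real.pi_pos.le]
    congr 1
    ring
  have hd : Real.Gamma (s + 1 / 2) * s.factorial =
      (2 * s).factorial / 2 ^ (2 * s) * √Real.pi := by
    have := Real.Gamma_mul_Gamma_add_half ((s : ℝ) + 1 / 2)
    rw [show (s : ℝ) + 1 / 2 + 1 / 2 = s + 1 by ring, Real.Gamma_nat_eq_factorial,
      show 2 * ((s : ℝ) + 1 / 2) = (2 * s : ℕ) + 1 by push_cast; ring,
      Real.Gamma_nat_eq_factorial,
      show 1 - (((2 * s : ℕ) : ℝ) + 1) = -((2 * s : ℕ) : ℝ) by ring,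
      Real.rpow_neg two_pos.le, Real.rpow_natCast] at this
    rw [this, div_eq_mul_inv]
  rw [e, integral_pow_two_mul_mul_exp_neg_sq] at h
  have hG : 0 < Real.Gamma (vmfOrder p + s + 1) :=
    Real.Gamma_pos_of_pos (by rw [← e]; positivity)
  have hs : (0 : ℝ) < s.factorial := by exact_mod_cast s.factorial_pos
  have hs2 : (0 : ℝ) < (2 * s).factorial := by exact_mod_cast (2 * s).factorial_pos
  have hd' : Real.Gamma (s + 1 / 2) =
      (2 * s).factorial / 2 ^ (2 * s) * √Real.pi / s.factorial := by
    rw [← hd]; field_simp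
  rw [← hpi, div_pow]
  rw [hd'] at h
  generalize (∫ y : UnitSphere p, inner ℝ v (y : EuclideanSpace ℝ (Fin p)) ^ (2 * s)
    ∂sphereMeasure p) = m at h ⊢
  field_simp at h ⊢
  linear_combination h

theorem integral_sphere_inner_odd_pow {p : ℕ} (hp : 0 < p) (v : EuclideanSpace ℝ (Fin p))
    {n : ℕ} (hn : Odd n) :
    ∫ y : UnitSphere p, inner ℝ v (y : EuclideanSpace ℝ (Fin p)) ^ n ∂sphereMeasure p = 0 := by
  have h := (integral_inner_pow_mul_exp_polar hp v n).symm.trans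
    (integral_inner_pow_mul_exp_neg_norm_sq hp v n)
  have hp' : (0 : ℝ) < p := by exact_mod_cast hp
  have hG : 0 < Real.Gamma (((p : ℝ) + n) / 2) := Real.Gamma_pos_of_pos (by positivity)
  rw [integral_odd_pow_mul_exp_neg_sq hn, zero_mul, mul_zero] at h
  exact (mul_eq_zero.1 h).resolve_right (by positivity)

/-! ### The Laplace transform of the surface measure -/

instance isFiniteMeasure_sphereMeasure (p : ℕ) : IsFiniteMeasure (sphereMeasure p) := by
  unfold sphereMeasure
  infer_instance

/-- Integration of the exponential series term by term over the sphere; only the terms of even degree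
survive. -/
theorem hasSum_integral_exp_inner {p : ℕ} (hp : 0 < p) (v : EuclideanSpace ℝ (Fin p)) :
    HasSum (fun s : ℕ => 2 * Real.pi ^ ((p : ℝ) / 2) *
        ((‖v‖ / 2) ^ (2 * s) / ((s.factorial : ℝ) * Real.Gamma (vmfOrder p + s + 1))))
      (∫ y : UnitSphere p, Real.exp (inner ℝ v (y : EuclideanSpace ℝ (Fin p)))
        ∂sphereMeasure p) := by
  have hc : Continuous fun y : UnitSphere p => inner ℝ v (y : EuclideanSpace ℝ (Fin p)) := by
    fun_prop
  have hb : ∀ (n : ℕ) (y : UnitSphere p),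
      ‖inner ℝ v (y : EuclideanSpace ℝ (Fin p)) ^ n / (n.factorial : ℝ)‖ ≤
        ‖v‖ ^ n / n.factorial := by
    intro n y
    rw [norm_div, norm_pow, Real.norm_natCast]
    gcongr
    simpa using norm_inner_le_norm (𝕜 := ℝ) v (y : EuclideanSpace ℝ (Fin p))
  have hi : ∀ n : ℕ, Integrable (fun y : UnitSphere p =>
      inner ℝ v (y : EuclideanSpace ℝ (Fin p)) ^ n / (n.factorial : ℝ)) (sphereMeasure p) :=
    fun n => .of_bound ((hc.pow n).div_const _).aestronglyMeasurable _
      (Eventually.of_forall (hb n))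
  have hs := hasSum_integral_of_summable_integral_norm hi <|
    Summable.of_nonneg_of_le (fun n => integral_nonneg fun y => norm_nonneg _)
      (fun n => (integral_mono (hi n).norm (integrable_const _) (hb n)).trans_eq
        (by rw [integral_const, smul_eq_mul]))
      ((Real.summable_pow_div_factorial ‖v‖).mul_left _)
  simp only [integral_div] at hs
  -- discard the terms of odd degree, which are zero
  rw [← (mul_right_injective₀ (two_ne_zero' ℕ)).hasSum_iff] at hs
  · simp only [Real.exp_eq_exp_ℝ, NormedSpace.exp_eq_tsum_div]
    simp only [← integral_sphere_inner_pow hp v]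
    exact hs
  · intro n hn
    have : Odd n := by
      rw [← Nat.not_even_iff_odd]
      rintro ⟨k, rfl⟩
      exact hn ⟨k, by simp only; omega⟩
    rw [integral_sphere_inner_odd_pow hp v this, zero_div]

/-- The power series of the normalising constant. It covers the
separately defined value at `κ = 0` as well, where only the constant term is left. -/
theorem vmfNorm_eq_tsum {p : ℕ} {κ : ℝ} (hκ : 0 ≤ κ) :
    vmfNorm p κ = ∑' s : ℕ, 2 * Real.pi ^ ((p : ℝ) / 2) *
      ((κ / 2) ^ (2 * s) / ((s.factorial : ℝ) * Real.Gamma (vmfOrder p + s + 1))) := by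
  have e : vmfOrder p + 1 = (p : ℝ) / 2 := by unfold vmfOrder; ring
  rcases hκ.eq_or_lt with rfl | hκ
  · rw [vmfNorm, if_pos rfl, tsum_eq_single 0 fun s hs => by simp [hs]]
    simp [e]
    ring
  · have h2 : (2 : ℝ) ^ ((p : ℝ) / 2) = 2 ^ vmfOrder p * 2 := by
      rw [← e, Real.rpow_add_one two_ne_zero]
    have h3 : 0 < κ ^ vmfOrder p := by positivity
    have h4 : (0 : ℝ) < 2 ^ vmfOrder p := by positivity
    rw [tsum_mul_left, vmfNorm, if_neg hκ.ne', besselI, Real.div_rpow hκ.le two_pos.le, e,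
      Real.mul_rpow two_pos.le Real.pi_pos.le, h2]
    field_simp

/-- The Laplace transform of the surface measure of the sphere, at a vector `v` of any norm, is the
von Mises-Fisher normalising constant at concentration `‖v‖`. -/
theorem integral_exp_inner {p : ℕ} (hp : 0 < p) (v : EuclideanSpace ℝ (Fin p)) :
    ∫ y : UnitSphere p, Real.exp (inner ℝ v (y : EuclideanSpace ℝ (Fin p))) ∂sphereMeasure p =
      vmfNorm p ‖v‖ := by
  rw [vmfNorm_eq_tsum (norm_nonneg v), (hasSum_integral_exp_inner hp v).tsum_eq]

/-- The series of `vmfNorm_eq_tsum` converges, because at a vector of norm `κ` it is the series of the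
integral in `hasSum_integral_exp_inner`. -/
theorem hasSum_vmfNorm {p : ℕ} (hp : 0 < p) {κ : ℝ} (hκ : 0 ≤ κ) :
    HasSum (fun s : ℕ => 2 * Real.pi ^ ((p : ℝ) / 2) *
      ((κ / 2) ^ (2 * s) / ((s.factorial : ℝ) * Real.Gamma (vmfOrder p + s + 1))))
      (vmfNorm p κ) := by
  -- any vector of norm `κ` will do
  have h := hasSum_integral_exp_inner hp (κ • EuclideanSpace.single ⟨0, hp⟩ (1 : ℝ))
  have hn : ‖κ • EuclideanSpace.single (⟨0, hp⟩ : Fin p) (1 : ℝ)‖ = κ := by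
    simp [norm_smul, abs_of_nonneg hκ]
  rw [integral_exp_inner hp, hn] at h
  exact h

theorem monotoneOn_vmfNorm {p : ℕ} (hp : 0 < p) : MonotoneOn (vmfNorm p) (Set.Ici 0) := by
  intro a ha b hb hab
  have ha : 0 ≤ a := ha
  refine hasSum_le (fun s => ?_) (hasSum_vmfNorm hp ha) (hasSum_vmfNorm hp (ha.trans hab))
  have hp' : (0 : ℝ) < p := by exact_mod_cast hp
  have hG : 0 < Real.Gamma (vmfOrder p + s + 1) :=
    Real.Gamma_pos_of_pos (by unfold vmfOrder; linarith [s.cast_nonneg (α := ℝ)])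
  gcongr

theorem vmfNorm_pos {p : ℕ} (hp : 0 < p) {κ : ℝ} (hκ : 0 ≤ κ) : 0 < vmfNorm p κ := by
  have hp' : (0 : ℝ) < p := by exact_mod_cast hp
  refine lt_of_lt_of_le ?_ (monotoneOn_vmfNorm hp Set.self_mem_Ici hκ hκ)
  rw [vmfNorm, if_pos rfl]
  have := Real.Gamma_pos_of_pos (half_pos hp')
  positivity

/-! ### Rényi divergence of the mechanism -/

theorem lintegral_ofReal_prod_sphere {R : ℕ} (p : Fin R → ℕ)
    (f : ∀ i, UnitSphere (p i) → ℝ) (hf : ∀ i, Continuous (f i)) (hf0 : ∀ i y, 0 ≤ f i y) :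
    ∫⁻ y, ENNReal.ofReal (∏ i, f i (y i)) ∂(Measure.pi fun i => sphereMeasure (p i)) =
      ENNReal.ofReal (∏ i, ∫ y, f i y ∂sphereMeasure (p i)) := by
  have hi : ∀ i, Integrable (f i) (sphereMeasure (p i)) := fun i =>
    (hf i).integrable_of_hasCompactSupport (HasCompactSupport.of_compactSpace _)
  rw [← integral_fintype_prod_eq_prod, ofReal_integral_eq_lintegral_ofReal]
  · exact Integrable.fintype_prod_dep hi
  · exact Eventually.of_forall fun y => Finset.prod_nonneg fun i _ => hf0 i _

/-- For measures with positive densities `f` and `g`, the Rényi divergence is given by the classical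
integral of `f ^ α * g ^ (1 - α)`. Positivity makes the two measures equivalent, so the value `⊤` does
not occur. -/
theorem renyiDiv_withDensity_ofReal {Y : Type*} [MeasurableSpace Y] (μ : Measure Y)
    [SigmaFinite μ] (α : ℝ) {f g : Y → ℝ} (hf : Measurable f) (hg : Measurable g)
    (hf0 : ∀ y, 0 < f y) (hg0 : ∀ y, 0 < g y) :
    renyiDiv α (μ.withDensity fun y => ENNReal.ofReal (f y))
        (μ.withDensity fun y => ENNReal.ofReal (g y)) =
      ((1 / (α - 1) : ℝ) : EReal) *
        ENNReal.log (∫⁻ y, ENNReal.ofReal (f y ^ α * g y ^ (1 - α)) ∂μ) := by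
  have : SigmaFinite (μ.withDensity fun y => ENNReal.ofReal (g y)) :=
    SigmaFinite.withDensity_ofReal g
  have hfg : Measurable fun y => ENNReal.ofReal (f y / g y) := (hf.div hg).ennreal_ofReal
  -- the first measure has density `f / g` with respect to the second
  have hP : (μ.withDensity fun y => ENNReal.ofReal (f y)) =
      (μ.withDensity fun y => ENNReal.ofReal (g y)).withDensity
        fun y => ENNReal.ofReal (f y / g y) := by
    rw [← withDensity_mul _ hg.ennreal_ofReal hfg]
    congr 1
    funext y
    rw [Pi.mul_apply, ← ENNReal.ofReal_mul (hg0 y).le, mul_div_cancel₀ _ (hg0 y).ne']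
  rw [renyiDiv, hP, if_pos (withDensity_absolutelyContinuous _ _),
    lintegral_congr_ae ((Measure.rnDeriv_withDensity _ hfg).mono fun y hy => by rw [hy]),
    lintegral_withDensity_eq_lintegral_mul _ hg.ennreal_ofReal (hfg.pow_const α)]
  congr 3
  funext y
  rw [Pi.mul_apply, ENNReal.ofReal_rpow_of_pos (div_pos (hf0 y) (hg0 y)),
    ← ENNReal.ofReal_mul (hg0 y).le, Real.div_rpow (hf0 y).le (hg0 y).le,
    Real.rpow_sub (hg0 y), Real.rpow_one]
  congr 1
  ring

theorem continuous_vmfDensity (p : ℕ) (κ : ℝ) (x : UnitSphere p) :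
    Continuous (vmfDensity p κ x) := by
  unfold vmfDensity
  fun_prop

theorem vmfDensity_pos {p : ℕ} (hp : 0 < p) {κ : ℝ} (hκ : 0 ≤ κ) (x y : UnitSphere p) :
    0 < vmfDensity p κ x y :=
  mul_pos (one_div_pos.2 (vmfNorm_pos hp hκ)) (Real.exp_pos _)

/-- The integrand of the Rényi divergence is again of exponential type, with mean direction replaced by
the affine combination `α x + (1 - α) x'`. -/
theorem vmfDensity_rpow_mul_rpow {p : ℕ} (hp : 0 < p) {κ : ℝ} (hκ : 0 ≤ κ) (α : ℝ)
    (x x' y : UnitSphere p) :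
    vmfDensity p κ x y ^ α * vmfDensity p κ x' y ^ (1 - α) =
      1 / vmfNorm p κ * Real.exp (inner ℝ
        (κ • (α • (x : EuclideanSpace ℝ (Fin p)) + (1 - α) • (x' : EuclideanSpace ℝ (Fin p))))
        (y : EuclideanSpace ℝ (Fin p))) := by
  have hC : 0 < 1 / vmfNorm p κ := one_div_pos.2 (vmfNorm_pos hp hκ)
  rw [vmfDensity, vmfDensity, Real.mul_rpow hC.le (Real.exp_pos _).le,
    Real.mul_rpow hC.le (Real.exp_pos _).le, mul_mul_mul_comm, ← Real.rpow_add hC,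
    ← Real.exp_mul, ← Real.exp_mul, ← Real.exp_add, real_inner_smul_left, inner_add_left,
    real_inner_smul_left, real_inner_smul_left]
  congr 2
  · rw [add_sub_cancel, Real.rpow_one]
  · ring

theorem isProbabilityMeasure_vmfMulti {R : ℕ} {p : Fin R → ℕ} {κ : Fin R → ℝ}
    (hp : ∀ i, 0 < p i) (hκ : ∀ i, 0 ≤ κ i) (x : ∀ i, UnitSphere (p i)) :
    IsProbabilityMeasure (vmfMulti p κ x) := by
  refine ⟨?_⟩
  rw [vmfMulti, withDensity_apply _ MeasurableSet.univ, Measure.restrict_univ,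
    lintegral_ofReal_prod_sphere p (fun i => vmfDensity (p i) (κ i) (x i))
      (fun i => continuous_vmfDensity _ _ _) (fun i y => (vmfDensity_pos (hp i) (hκ i) _ _).le),
    Finset.prod_eq_one, ENNReal.ofReal_one]
  intro i _
  simp only [vmfDensity, ← real_inner_smul_left, integral_const_mul, integral_exp_inner (hp i)]
  rw [norm_smul, norm_eq_of_mem_sphere, mul_one, Real.norm_of_nonneg (hκ i),
    one_div_mul_cancel (vmfNorm_pos (hp i) (hκ i)).ne']

/-- The exact Rényi divergence between two outputs of the mechanism. -/
theorem renyiDiv_vmfMulti {R : ℕ} {p : Fin R → ℕ} {κ : Fin R → ℝ}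
    (hp : ∀ i, 0 < p i) (hκ : ∀ i, 0 ≤ κ i) (α : ℝ) (x x' : ∀ i, UnitSphere (p i)) :
    renyiDiv α (vmfMulti p κ x) (vmfMulti p κ x') =
      ((1 / (α - 1) * ∑ i, Real.log (vmfNorm (p i)
        (κ i * ‖α • (x i : EuclideanSpace ℝ (Fin (p i))) +
          (1 - α) • (x' i : EuclideanSpace ℝ (Fin (p i)))‖) / vmfNorm (p i) (κ i)) : ℝ) :
            EReal) := by
  have hpos : ∀ i (a b : UnitSphere (p i)), 0 < vmfDensity (p i) (κ i) a b :=
    fun i => vmfDensity_pos (hp i) (hκ i)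
  have hm : ∀ x : ∀ i, UnitSphere (p i),
      Measurable fun y : ∀ i, UnitSphere (p i) => ∏ i, vmfDensity (p i) (κ i) (x i) (y i) :=
    fun x => Finset.measurable_prod _ fun i _ =>
      (continuous_vmfDensity _ _ _).measurable.comp (measurable_pi_apply i)
  rw [vmfMulti, vmfMulti, renyiDiv_withDensity_ofReal _ α (hm x) (hm x')
    (fun y => Finset.prod_pos fun i _ => hpos i _ _)
    (fun y => Finset.prod_pos fun i _ => hpos i _ _)]
  simp only [← Real.finsetProd_rpow _ _ fun i _ => (hpos i _ _).le, ← Finset.prod_mul_distrib,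
    vmfDensity_rpow_mul_rpow (hp _) (hκ _)]
  have hq : ∀ i, 0 < vmfNorm (p i)
      (κ i * ‖α • (x i : EuclideanSpace ℝ (Fin (p i))) +
        (1 - α) • (x' i : EuclideanSpace ℝ (Fin (p i)))‖) / vmfNorm (p i) (κ i) := fun i =>
    div_pos (vmfNorm_pos (hp i) (mul_nonneg (hκ i) (norm_nonneg _)))
      (vmfNorm_pos (hp i) (hκ i))
  rw [lintegral_ofReal_prod_sphere p (fun i y => 1 / vmfNorm (p i) (κ i) * Real.exp (inner ℝ
      (κ i • (α • (x i : EuclideanSpace ℝ (Fin (p i))) +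
        (1 - α) • (x' i : EuclideanSpace ℝ (Fin (p i)))))
      (y : EuclideanSpace ℝ (Fin (p i))))) (fun i => by fun_prop)
    (fun i y => mul_nonneg (one_div_pos.2 (vmfNorm_pos (hp i) (hκ i))).le (Real.exp_pos _).le)]
  simp only [one_div_mul_eq_div (vmfNorm _ _), integral_div, integral_exp_inner (hp _),
    norm_smul (κ _), Real.norm_of_nonneg (hκ _)]
  rw [ENNReal.log_ofReal_of_pos (Finset.prod_pos fun i _ => hq i),
    Real.log_prod fun i _ => (hq i).ne', EReal.coe_mul]

/-! ### The privacy bound -/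

/-- The bound on a block, rewritten in terms of Bessel functions: the powers of `κ` in `vmfNorm` cancel
up to `c ^ (-ν)`. At `κ = 0` both sides vanish. -/
theorem log_vmfNorm_mul_div {p : ℕ} (hp : 0 < p) {c κ : ℝ} (hc : 0 < c) (hκ : 0 ≤ κ) :
    Real.log (vmfNorm p (κ * c) / vmfNorm p κ) =
      vmfOrder p * Real.log (1 / c) + Real.log (besselIRatio (vmfOrder p) c κ) := by
  rcases hκ.eq_or_lt with rfl | hκ
  · rw [zero_mul, div_self (vmfNorm_pos hp le_rfl).ne', besselIRatio, if_pos rfl,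
      Real.log_rpow hc, one_div, Real.log_inv, Real.log_one]
    ring
  · have hB : ∀ t : ℝ, 0 < t → besselI (vmfOrder p) t ≠ 0 := by
      intro t ht h0
      have := vmfNorm_pos hp ht.le
      simp [vmfNorm, ht.ne', h0] at this
    have hcκ : 0 < c * κ := mul_pos hc hκ
    have hr : besselIRatio (vmfOrder p) c κ ≠ 0 := by
      rw [besselIRatio, if_neg hκ.ne']
      exact div_ne_zero (hB _ hcκ) (hB _ hκ)
    have h1 : 0 < c ^ vmfOrder p := by positivity
    have h2 : 0 < κ ^ vmfOrder p := by positivity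
    have h3 : 0 < (2 * Real.pi) ^ (vmfOrder p + 1) := by positivity
    have h4 := hB _ hκ
    have e : vmfNorm p (κ * c) / vmfNorm p κ =
        (1 / c) ^ vmfOrder p * besselIRatio (vmfOrder p) c κ := by
      rw [mul_comm κ, vmfNorm, vmfNorm, if_neg hcκ.ne', if_neg hκ.ne', besselIRatio,
        if_neg hκ.ne', Real.mul_rpow hc.le hκ.le, Real.div_rpow zero_le_one hc.le, Real.one_rpow]
      field_simp
    rw [e, Real.log_mul (by positivity) hr, Real.log_rpow (one_div_pos.2 hc)]

/-- Equality holds for `x' = -x`, the worst pair of inputs. -/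
theorem norm_affine_combination_le {E : Type*} [NormedAddCommGroup E] [NormedSpace ℝ E] {α : ℝ}
    (hα : 1 ≤ α) {x x' : E} (hx : ‖x‖ = 1) (hx' : ‖x'‖ = 1) :
    ‖α • x + (1 - α) • x'‖ ≤ 2 * α - 1 := by
  refine (norm_add_le _ _).trans_eq ?_
  rw [norm_smul, norm_smul, hx, hx', Real.norm_of_nonneg (by linarith),
    Real.norm_of_nonpos (by linarith)]
  ring

theorem mainTheorem3 (R : ℕ) (p : Fin R → ℕ) (κ : Fin R → ℝ) (hp : ∀ i, 2 ≤ p i)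
    (hκ : ∀ i, 0 ≤ κ i) (α : ℝ) (hα : 1 < α)
    (Adj : (∀ i, UnitSphere (p i)) → (∀ i, UnitSphere (p i)) → Prop) :
    IsRDP Adj (vmfMulti p κ) α
      ((∑ i, (vmfOrder (p i) * Real.log (1 / (2 * α - 1)) +
        Real.log (besselIRatio (vmfOrder (p i)) (2 * α - 1) (κ i)))) / (α - 1)) := by
  have hp0 : ∀ i, 0 < p i := fun i => two_pos.trans_le (hp i)
  refine ⟨isProbabilityMeasure_vmfMulti hp0 hκ, fun x x' _ => ?_⟩
  rw [renyiDiv_vmfMulti hp0 hκ, EReal.coe_le_coe_iff, one_div_mul_eq_div]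
  have hα' : 0 < α - 1 := sub_pos.2 hα
  gcongr with i
  rw [← log_vmfNorm_mul_div (hp0 i) (by linarith) (hκ i)]
  have h0 := mul_nonneg (hκ i) (norm_nonneg (α • (x i : EuclideanSpace ℝ (Fin (p i))) +
    (1 - α) • (x' i : EuclideanSpace ℝ (Fin (p i)))))
  have hle := mul_le_mul_of_nonneg_left (norm_affine_combination_le hα.le
    (norm_eq_of_mem_sphere (x i)) (norm_eq_of_mem_sphere (x' i))) (hκ i)
  have hpos := vmfNorm_pos (hp0 i) (hκ i)
  refine Real.log_le_log (div_pos (vmfNorm_pos (hp0 i) h0) hpos) ?_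
  exact div_le_div_of_nonneg_right (monotoneOn_vmfNorm (hp0 i) h0 (h0.trans hle) hle) hpos.le
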